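/- Let $q$ be an odd prime power. There is a function $g:\mathbb{N}\to\mathbb{R}$, depending only on $q$, with $g(m)=o(m)$ as $m\to\infty$, such that the following holds. Let $F\in\mathbb{F}_q[T]$ be irreducible of degree $r$, and let $m$ be a positive integer with $m\le r$. For $x\in\mathbb{F}_q[T]$ let $\deg_F x$ be the degree of the unique $x'$ with $\deg x'<r$ and $x'\equiv x \pmod F$ (where $\deg 0=-\infty$). Let $\alpha:\mathbb{F}_q[T]/\langle F\rangle\to\mathbb{C}$ be a weight supported on $\{x:\deg_F x<m\}$, and write $\alpha(x)$ also for its value at the class of a polynomial $x$. Put $\|\alpha\|_1=\sum_{x}|\alpha(x)|$ and $\|\alpha\|_\infty=\max_x|\alpha(x)|$, with $x$ running over $\mathbb{F}_q[T]/\langle F\rangle$, and $$E^{\mathrm{sqrt}}_{F,2}(\alpha)=\sum_{\substack{x_1,x_2,x_3,x_4\in\mathbb{F}_q[T],\ \deg x_i<r\\ x_1+x_2\equiv x_3+x_4\ (\mathrm{mod}\ F)}}\alpha(x_1^2)\,\overline{\alpha(x_2^2)}\,\alpha(x_3^2)\,\overline{\alpha(x_4^2)}.$$ Then $E^{\mathrm{sqrt}}_{F,2}(\alpha)$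 is a real number and $$E^{\mathrm{sqrt}}_{F,2}(\alpha)\le\|\alpha\|_1^{4/3}\,\|\alpha\|_\infty^{8/3}\,q^{m+g(m)}\left(q^{7m/6-r/2}+1\right).$$ -/

import Mathlib

open Polynomial Asymptotics Filter

universe u

noncomputable section

/-- `deg_F x`: the degree of the unique `x'` with `deg x' < deg F` and `x' ≡ x (mod F)`,
with the convention `deg 0 = -∞` (here `⊥`). -/
def degMod {K : Type u} [Field K] (F x : K[X]) : WithBot ℕ :=
  (x % F).degree

/-- There are finitely many polynomials of degree `< r` over a finite field. -/
theorem finite_degree_lt (K : Type u) [Field K] [Finite K] (r : ℕ) :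
    {x : K[X] | x.degree < r}.Finite := by
  have h : Finite (degreeLT K r) := Finite.of_equiv _ (degreeLTEquiv K r).toEquiv.symm
  refine (Set.toFinite (degreeLT K r : Set K[X])).subset ?_
  intro x hx
  exact mem_degreeLT.2 hx

/-- The set `I_r` of polynomials of degree `< r`. -/
def polyDegLT (K : Type u) [Field K] [Finite K] (r : ℕ) : Finset K[X] :=
  (finite_degree_lt K r).toFinset

/-- The value at a polynomial `x` of a weight on `K[T]/(F)`, through the quotient map. -/
def weightAt {K : Type u} [Field K] {F : K[X]} (α : (K[X] ⧸ Ideal.span {F}) → ℂ) (x : K[X]) : ℂ :=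
  α (Ideal.Quotient.mk (Ideal.span {F}) x)

/-- The additive energy of modular square roots
`∑ α(x₁²) conj(α(x₂²)) α(x₃²) conj(α(x₄²))`, over the `x₁, x₂, x₃, x₄` of degree `< deg F` with
`x₁ + x₂ ≡ x₃ + x₄ (mod F)`. It is a priori a complex number. -/
def sqrtEnergy {K : Type u} [Field K] [Finite K] (F : K[X])
    (α : (K[X] ⧸ Ideal.span {F}) → ℂ) : ℂ :=
  open Classical in
  ∑ x₁ ∈ polyDegLT K F.natDegree, ∑ x₂ ∈ polyDegLT K F.natDegree,
    ∑ x₃ ∈ polyDegLT K F.natDegree, ∑ x₄ ∈ polyDegLT K F.natDegree,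
      if F ∣ (x₁ + x₂) - (x₃ + x₄) then
        weightAt α (x₁ ^ 2) * (starRingEnd ℂ) (weightAt α (x₂ ^ 2)) *
          weightAt α (x₃ ^ 2) * (starRingEnd ℂ) (weightAt α (x₄ ^ 2))
      else 0

/-- The `ℓ₁` norm of a weight on a finite set. -/
def l1Norm {G : Type u} (α : G → ℂ) : ℝ := ∑ᶠ x, ‖α x‖

/-- The `ℓ_∞` norm of a weight on a finite non-empty set. -/
def lInftyNorm {G : Type u} (α : G → ℂ) : ℝ := ⨆ x, ‖α x‖

end

/-!
Writing `l = x₂ - x₃ = x₄ - x₁`, the energy is `∑ A(l)²`, where `A(l)` is the correlation of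
`α(x²)` with `α((x + l)²)`; it is real, since `x ↦ -x - l` exchanges the two factors. Up to
`‖α‖_∞²`, `A(l)` is at most the number `r(l)` of `x` such that `x²` and `(x + l)²` both have small
degree. For `l ≠ 0` the difference `w` of these squares has small degree and satisfies
`w² ≡ l² s - l⁴` with `s` of small degree. A pair `w, w'` of such elements gives a point
`(w² - w'², s - s')` of the lattice `u₁ ≡ l² u₂ (mod F)` in the box `deg u₁ < 2m`, `deg u₂ < m`,
and by the divisor bound each point comes from at most `q^o(m)` pairs.

The lattice has determinant `F`. If it has a point with `u₂ ≠ 0` in the box, then either it has at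
most `q^(3m - r)` points there, or all of them are multiples of one primitive vector `(b, c)`. If
there are `q^h` multiples then
`l² ≡ b / c` leaves `O(q^(3m - 2h))` possibilities for `l`, so that the sum of `r(l)⁴` over these
exceptional `l` is at most `q^(3m + o(m))`. The remaining `l` are controlled by
`∑ |A(l)| ≤ 4 ‖α‖₁²`, and the exceptional ones by Hölder's inequality between the first and the
fourth moment.
-/

open scoped Finset

section PolynomialsOverFiniteField

variable {K : Type*} [Field K]

theorem degree_mul_lt_of_natDegree_add_le {p s : K[X]} {n k : ℕ} (hs : s.degree < k)
    (hp : p.natDegree + k ≤ n) : (p * s).degree < n := by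
  rcases eq_or_ne p 0 with rfl | hp0
  · simp
  rcases eq_or_ne s 0 with rfl | hs0
  · simp
  rw [← natDegree_lt_iff_degree_lt hs0] at hs
  rw [← natDegree_lt_iff_degree_lt (mul_ne_zero hp0 hs0), natDegree_mul hp0 hs0]
  omega

theorem degree_lt_sub_of_degree_mul_lt {p s : K[X]} {n : ℕ} (hp : p ≠ 0)
    (hs : (p * s).degree < n) : s.degree < (n - p.natDegree : ℕ) := by
  rcases eq_or_ne s 0 with rfl | hs0
  · simp
  rw [← natDegree_lt_iff_degree_lt (mul_ne_zero hp hs0), natDegree_mul hp hs0] at hs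
  rw [← natDegree_lt_iff_degree_lt hs0]
  omega

theorem degree_sub_lt_of_lt {p s : K[X]} {n : WithBot ℕ} (hp : p.degree < n) (hs : s.degree < n) :
    (p - s).degree < n :=
  (degree_sub_le p s).trans_lt (max_lt hp hs)

variable [Finite K]

theorem mem_polyDegLT {n : ℕ} {p : K[X]} : p ∈ polyDegLT K n ↔ p.degree < n := by
  simp [polyDegLT]

theorem card_polyDegLT (K : Type*) [Field K] [Finite K] (n : ℕ) :
    #(polyDegLT K n) = Nat.card K ^ n :=
  calc #(polyDegLT K n) = Nat.card (polyDegLT K n) := (Nat.card_eq_finsetCard _).symm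
    _ = Nat.card (degreeLT K n) :=
      Nat.card_congr (Equiv.subtypeEquivRight fun p => by rw [mem_polyDegLT, mem_degreeLT])
    _ = Nat.card K ^ n := by
      rw [Nat.card_congr (degreeLTEquiv K n).toEquiv, Nat.card_fun, Nat.card_fin]

open scoped Classical in
theorem card_filter_dvd_polyDegLT_le {F : K[X]} (hF : F ≠ 0) (n : ℕ) :
    #{p ∈ polyDegLT K n | F ∣ p} ≤ Nat.card K ^ (n - F.natDegree) := by
  rw [← card_polyDegLT]
  refine (Finset.card_le_card (t := (polyDegLT K (n - F.natDegree)).image (F * ·)) ?_).trans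
    Finset.card_image_le
  intro p hp
  obtain ⟨hp, s, rfl⟩ := Finset.mem_filter.1 hp
  exact Finset.mem_image_of_mem _
    (mem_polyDegLT.2 (degree_lt_sub_of_degree_mul_lt hF (mem_polyDegLT.1 hp)))

end PolynomialsOverFiniteField

section DivisorBound

open UniqueFactorizationMonoid

theorem card_Iic_multiset_le {ι : Type*} [DecidableEq ι] (s : Multiset ι) (A : Finset ι) :
    #(Finset.Iic s) ≤ (s.card + 1) ^ #A * 2 ^ (s.filter (· ∉ A)).card := by
  rw [Multiset.card_Iic, ← Finset.prod_filter_mul_prod_filter_not s.toFinset (· ∈ A)]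
  refine Nat.mul_le_mul ?_ ?_
  · calc ∏ i ∈ s.toFinset with i ∈ A, (s.count i + 1) ≤ (s.card + 1) ^ #{i ∈ s.toFinset | i ∈ A} :=
          Finset.prod_le_pow_card _ _ _ fun i _ => Nat.succ_le_succ (s.count_le_card i)
      _ ≤ (s.card + 1) ^ #A := by
          gcongr
          · omega
          · exact fun i hi => (Finset.mem_filter.1 hi).2
  · calc ∏ i ∈ s.toFinset with i ∉ A, (s.count i + 1)
        ≤ ∏ i ∈ s.toFinset with i ∉ A, 2 ^ s.count i :=
          Finset.prod_le_prod' fun i _ => Nat.lt_two_pow_self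
      _ = 2 ^ ∑ i ∈ (s.filter (· ∉ A)).toFinset, (s.filter (· ∉ A)).count i := by
          rw [Finset.prod_pow_eq_pow_sum, Multiset.toFinset_filter]
          congr 1
          refine Finset.sum_congr rfl fun i hi => ?_
          rw [Multiset.count_filter_of_pos (p := (· ∉ A)) (Finset.mem_filter.1 hi).2]
      _ = 2 ^ (s.filter (· ∉ A)).card := by rw [Multiset.toFinset_sum_count_eq]

variable {K : Type*} [Field K]

open scoped Classical in
theorem sum_natDegree_normalizedFactors {x : K[X]} (hx : x ≠ 0) :
    ((normalizedFactors x).map natDegree).sum = x.natDegree := by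
  rw [← natDegree_multiset_prod _ (zero_notMem_normalizedFactors x)]
  exact natDegree_eq_of_degree_eq (degree_eq_degree_of_associated (prod_normalizedFactors hx))

open scoped Classical in
theorem card_filter_normalizedFactors_mul_le {x : K[X]} (hx : x ≠ 0) (k : ℕ) {P : K[X] → Prop}
    [DecidablePred P] (hP : ∀ p ∈ normalizedFactors x, P p → k ≤ p.natDegree) :
    ((normalizedFactors x).filter P).card * k ≤ x.natDegree := by
  have hlow : ∀ d ∈ ((normalizedFactors x).filter P).map natDegree, k ≤ d := by
    intro d hd
    obtain ⟨p, hp, rfl⟩ := Multiset.mem_map.1 hd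
    exact hP p (Multiset.mem_filter.1 hp).1 (Multiset.mem_filter.1 hp).2
  calc ((normalizedFactors x).filter P).card * k
      ≤ (((normalizedFactors x).filter P).map natDegree).sum := by
        simpa using Multiset.card_nsmul_le_sum hlow
    _ ≤ ((normalizedFactors x).map natDegree).sum := by
        conv_rhs => rw [← Multiset.filter_add_not P (normalizedFactors x)]
        simp
    _ = x.natDegree := sum_natDegree_normalizedFactors hx

open scoped Classical in
theorem card_normalizedFactors_le {x : K[X]} (hx : x ≠ 0) :
    (normalizedFactors x).card ≤ x.natDegree := by
  simpa using card_filter_normalizedFactors_mul_le hx 1 (P := fun _ => True) fun p hp _ =>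
    (irreducible_of_normalized_factor p hp).natDegree_pos

variable [Finite K]

open scoped Classical in
theorem card_le_mul_card_Iic_of_forall_dvd {x : K[X]} (hx : x ≠ 0) {A : Finset K[X]}
    (hA : ∀ d ∈ A, d ∣ x) : #A ≤ Nat.card K * #(Finset.Iic (normalizedFactors x)) := by
  have := Fintype.ofFinite K
  rw [Nat.card_eq_fintype_card, ← Finset.card_univ, ← Finset.card_product]
  refine Finset.card_le_card_of_injOn (fun d => (d.leadingCoeff, normalizedFactors d)) ?_ ?_
  · intro d hd
    have hle := (dvd_iff_normalizedFactors_le_normalizedFactors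
      (ne_zero_of_dvd_ne_zero hx (hA d hd)) hx).1 (hA d hd)
    simpa using hle
  · intro d _ e _ hde
    obtain ⟨hlead, hfac⟩ := Prod.ext_iff.1 hde
    rw [← leadingCoeff_mul_prod_normalizedFactors d, ← leadingCoeff_mul_prod_normalizedFactors e]
    exact congrArg₂ (fun c s => C c * Multiset.prod s) hlead hfac

theorem card_le_of_forall_dvd {x : K[X]} (hx : x ≠ 0) {n : ℕ} (hn : x.natDegree ≤ n)
    {A : Finset K[X]} (hA : ∀ d ∈ A, d ∣ x) (k : ℕ) :
    #A ≤ Nat.card K * ((n + 1) ^ Nat.card K ^ (k + 1) * 2 ^ (n / (k + 1))) := by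
  classical
  have hlarge : ((normalizedFactors x).filter (· ∉ polyDegLT K (k + 1))).card ≤ n / (k + 1) := by
    rw [Nat.le_div_iff_mul_le k.succ_pos]
    refine (card_filter_normalizedFactors_mul_le hx (k + 1) fun p _ hp => ?_).trans hn
    rw [mem_polyDegLT, not_lt] at hp
    exact le_natDegree_of_coe_le_degree hp
  calc #A ≤ Nat.card K * #(Finset.Iic (normalizedFactors x)) :=
        card_le_mul_card_Iic_of_forall_dvd hx hA
    _ ≤ Nat.card K * (((normalizedFactors x).card + 1) ^ #(polyDegLT K (k + 1)) *
          2 ^ ((normalizedFactors x).filter (· ∉ polyDegLT K (k + 1))).card) :=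
        Nat.mul_le_mul_left _ (card_Iic_multiset_le _ _)
    _ ≤ Nat.card K * ((n + 1) ^ Nat.card K ^ (k + 1) * 2 ^ (n / (k + 1))) := by
        rw [card_polyDegLT]
        gcongr
        · exact (card_normalizedFactors_le hx).trans hn
        · exact one_le_two

/-- A bound for the number of divisors of a nonzero polynomial of degree at most `n` over a field
with `q` elements. The divisors are counted by separating the prime factors of degree at most `k`
from the others, and the infimum makes the optimal choice of `k`. -/
noncomputable def divisorBound (q n : ℕ) : ℕ :=
  ⨅ k : ℕ, q * ((n + 1) ^ q ^ (k + 1) * 2 ^ (n / (k + 1)))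

theorem card_le_divisorBound_of_forall_dvd {x : K[X]} (hx : x ≠ 0) {n : ℕ} (hn : x.natDegree ≤ n)
    {A : Finset K[X]} (hA : ∀ d ∈ A, d ∣ x) : #A ≤ divisorBound (Nat.card K) n :=
  le_ciInf (card_le_of_forall_dvd hx hn hA)

theorem card_le_divisorBound_of_sq_sub_sq (h2 : (2 : K) ≠ 0) {x : K[X]} (hx : x ≠ 0) {n : ℕ}
    (hn : x.natDegree ≤ n) {A : Finset (K[X] × K[X])} (hA : ∀ w ∈ A, w.1 ^ 2 - w.2 ^ 2 = x) :
    #A ≤ divisorBound (Nat.card K) n := by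
  classical
  have hfac : ∀ w ∈ A, x = (w.1 - w.2) * (w.1 + w.2) := fun w hw => by rw [← hA w hw]; ring
  rw [← Finset.card_image_of_injOn (f := fun w : K[X] × K[X] => w.1 - w.2)]
  · refine card_le_divisorBound_of_forall_dvd hx hn fun d hd => ?_
    obtain ⟨w, hw, rfl⟩ := Finset.mem_image.1 hd
    exact ⟨_, hfac w hw⟩
  · intro w hw z hz (hdiff : w.1 - w.2 = z.1 - z.2)
    have hne : w.1 - w.2 ≠ 0 := left_ne_zero_of_mul (hfac w hw ▸ hx)
    have hsum : w.1 + w.2 = z.1 + z.2 :=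
      mul_left_cancel₀ hne (by rw [← hfac w hw, hdiff, ← hfac z hz])
    have h2' : (2 : K[X]) ≠ 0 := (_root_.map_ne_zero C).2 h2
    refine Prod.ext (mul_left_cancel₀ h2' ?_) (mul_left_cancel₀ h2' ?_)
    · linear_combination hdiff + hsum
    · linear_combination hsum - hdiff

theorem one_le_divisorBound {q : ℕ} (hq : 0 < q) (n : ℕ) : 1 ≤ divisorBound q n :=
  le_ciInf fun _ => Nat.succ_le_of_lt (by positivity)

theorem log_divisorBound_le {q : ℕ} (hq : 0 < q) (n k : ℕ) :
    Real.log (divisorBound q n) ≤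
      Real.log q + (q : ℝ) ^ (k + 1) * Real.log (n + 1) + n / (k + 1) * Real.log 2 := by
  have hle : (divisorBound q n : ℝ) ≤ q * ((n + 1) ^ q ^ (k + 1) * 2 ^ (n / (k + 1))) := by
    exact_mod_cast (ciInf_le (OrderBot.bddBelow _) k : divisorBound q n ≤ _)
  have hpos : (0 : ℝ) < divisorBound q n := by exact_mod_cast one_le_divisorBound hq n
  have hdiv : ((n / (k + 1) : ℕ) : ℝ) ≤ n / (k + 1) := by
    exact_mod_cast Nat.cast_div_le (α := ℝ) (m := n) (n := k + 1)
  calc Real.log (divisorBound q n)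
      ≤ Real.log (q * ((n + 1) ^ q ^ (k + 1) * 2 ^ (n / (k + 1)))) := Real.log_le_log hpos hle
    _ = Real.log q + (q : ℝ) ^ (k + 1) * Real.log (n + 1) + (n / (k + 1) : ℕ) * Real.log 2 := by
        rw [Real.log_mul (by positivity) (by positivity),
          Real.log_mul (by positivity) (by positivity), Real.log_pow, Real.log_pow]
        push_cast
        ring
    _ ≤ _ := by gcongr

theorem isLittleO_const_natCast (c : ℝ) : (fun _ : ℕ => c) =o[atTop] fun n : ℕ => (n : ℝ) :=
  (isLittleO_const_id_atTop c).natCast_atTop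

theorem isLittleO_log_natCast_add_one :
    (fun n : ℕ => Real.log (n + 1)) =o[atTop] fun n : ℕ => (n : ℝ) := by
  have hlog : (fun n : ℕ => Real.log (n + 1)) =o[atTop] fun n : ℕ => (n : ℝ) + 1 :=
    Real.isLittleO_log_id_atTop.comp_tendsto
      (tendsto_atTop_add_const_right _ _ tendsto_natCast_atTop_atTop)
  exact hlog.trans_isBigO ((isBigO_refl _ _).add (isLittleO_const_natCast 1).isBigO)

theorem isLittleO_log_divisorBound {q : ℕ} (hq : 0 < q) :
    (fun n : ℕ => Real.log (divisorBound q n)) =o[atTop] fun n : ℕ => (n : ℝ) := by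
  rw [isLittleO_iff]
  intro ε hε
  obtain ⟨k, hk⟩ := exists_nat_gt (2 * Real.log 2 / ε)
  have hmain := (isLittleO_const_natCast (Real.log q)).add
    (isLittleO_log_natCast_add_one.const_mul_left ((q : ℝ) ^ (k + 1)))
  filter_upwards [isLittleO_iff.1 hmain (half_pos hε)] with n hn
  have hlarge : (n : ℝ) / (k + 1) * Real.log 2 ≤ ε / 2 * n := by
    rw [div_lt_iff₀ hε] at hk
    rw [div_mul_eq_mul_div, div_le_iff₀ (by positivity)]
    nlinarith [n.cast_nonneg (α := ℝ), mul_nonneg n.cast_nonneg hε.le]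
  rw [Real.norm_of_nonneg (Real.log_natCast_nonneg _), Real.norm_of_nonneg n.cast_nonneg]
  rw [Real.norm_of_nonneg n.cast_nonneg] at hn
  linarith [log_divisorBound_le hq n k, (Real.le_norm_self _).trans hn]

end DivisorBound

section SquareRoots

variable {R : Type*} [CommRing R] [IsDomain R] [Fintype R]

open scoped Classical in
theorem card_filter_sq_eq_le_two (a : R) : #{x : R | x ^ 2 = a} ≤ 2 :=
  calc #{x : R | x ^ 2 = a} ≤ #(nthRoots 2 a).toFinset :=
        Finset.card_le_card fun x hx => by simpa [mem_nthRoots] using hx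
    _ ≤ (nthRoots 2 a).card := Multiset.toFinset_card_le _
    _ ≤ 2 := card_nthRoots 2 a

end SquareRoots

section BoxLattice

variable {K : Type*} [Field K] {R : Type*} [CommRing R] {φ : K[X] →+* R} {F : K[X]}

theorem map_ne_zero_of_degree_lt (hφ : ∀ p, φ p = 0 ↔ F ∣ p) {p : K[X]} (hp : p ≠ 0)
    (hdeg : p.degree < F.degree) : φ p ≠ 0 :=
  fun h => hp (eq_zero_of_dvd_of_degree_lt ((hφ p).1 h) hdeg)

/-- The residue `a` is the quotient `φ b / φ c` of a polynomial `b` of degree less than `M` by a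
polynomial `c` of degree less than `N`. -/
def IsSmallQuotient (φ : K[X] →+* R) (M N : ℕ) (a : R) : Prop :=
  ∃ b c : K[X], b.degree < M ∧ c.degree < N ∧ φ c ≠ 0 ∧ φ b = a * φ c

variable [Finite K]

open scoped Classical in
/-- The part of the lattice `{(u₁, u₂) | u₁ ≡ a u₂}` lying in the box `deg u₁ < M`, `deg u₂ < N`. -/
noncomputable def boxLattice (φ : K[X] →+* R) (a : R) (M N : ℕ) : Finset (K[X] × K[X]) :=
  {u ∈ polyDegLT K M ×ˢ polyDegLT K N | φ u.1 = a * φ u.2}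

theorem mem_boxLattice {a : R} {M N : ℕ} {u : K[X] × K[X]} :
    u ∈ boxLattice φ a M N ↔ (u.1.degree < M ∧ u.2.degree < N) ∧ φ u.1 = a * φ u.2 := by
  simp only [boxLattice, Finset.mem_filter, Finset.mem_product, mem_polyDegLT]

open scoped Classical in
theorem card_filter_boxLattice_le {a : R} {M N : ℕ} {b c : K[X]} (hbc : IsCoprime b c)
    (hb : b ≠ 0) (hc : c ≠ 0) (d : K[X]) :
    #{u ∈ boxLattice φ a M N | b * u.2 - c * u.1 = d} ≤
      Nat.card K ^ min (M - b.natDegree) (N - c.natDegree) := by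
  set S := {u ∈ boxLattice φ a M N | b * u.2 - c * u.1 = d}
  have hmem : ∀ {u}, u ∈ S → u.1.degree < M ∧ u.2.degree < N ∧ b * u.2 - c * u.1 = d := by
    intro u hu
    obtain ⟨huL, hud⟩ := Finset.mem_filter.1 hu
    exact ⟨(mem_boxLattice.1 huL).1.1, (mem_boxLattice.1 huL).1.2, hud⟩
  obtain hempty | ⟨v, hv⟩ := S.eq_empty_or_nonempty
  · simp [hempty]
  rw [← card_polyDegLT]
  refine (Finset.card_le_card fun u hu => ?_).trans
    (Finset.card_image_le (f := fun s => (v.1 + b * s, v.2 + c * s)))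
  obtain ⟨hu₁, hu₂, hud⟩ := hmem hu
  obtain ⟨hv₁, hv₂, hvd⟩ := hmem hv
  have hparallel : b * (u.2 - v.2) = c * (u.1 - v.1) := by linear_combination hud - hvd
  obtain ⟨s, hs₁⟩ : b ∣ u.1 - v.1 := hbc.dvd_of_dvd_mul_left ⟨_, hparallel.symm⟩
  have hs₂ : u.2 - v.2 = c * s :=
    mul_left_cancel₀ hb (by rw [hparallel, hs₁]; ring)
  refine Finset.mem_image.2 ⟨s, mem_polyDegLT.2 ?_, ?_⟩
  · have hlt₁ := degree_lt_sub_of_degree_mul_lt hb (hs₁ ▸ degree_sub_lt_of_lt hu₁ hv₁)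
    have hlt₂ := degree_lt_sub_of_degree_mul_lt hc (hs₂ ▸ degree_sub_lt_of_lt hu₂ hv₂)
    rcases min_choice (M - b.natDegree) (N - c.natDegree) with h | h <;> rwa [h]
  · rw [← hs₁, ← hs₂, add_sub_cancel, add_sub_cancel]

/-- The determinants `b * u₂ - c * u₁` are multiples of `F`, so there are few of them, and `u` is
determined by its determinant up to a multiple of the primitive vector `(b, c)`. -/
theorem card_boxLattice_le (hφ : ∀ p, φ p = 0 ↔ F ∣ p) (hF : F ≠ 0) {a : R} {M N : ℕ} {b c : K[X]}
    (hbc : IsCoprime b c) (hb : b ≠ 0) (hc : c ≠ 0) (hbM : b.natDegree ≤ M) (hcN : c.natDegree ≤ N)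
    (ha : φ b = a * φ c) :
    #(boxLattice φ a M N) ≤ Nat.card K ^ min (M - b.natDegree) (N - c.natDegree) *
      Nat.card K ^ (M + N - min (M - b.natDegree) (N - c.natDegree) - F.natDegree) := by
  classical
  set h := min (M - b.natDegree) (N - c.natDegree)
  have hmaps : ∀ u ∈ boxLattice φ a M N,
      b * u.2 - c * u.1 ∈ {p ∈ polyDegLT K (M + N - h) | F ∣ p} := by
    intro u hu
    obtain ⟨⟨hu₁, hu₂⟩, hu⟩ := mem_boxLattice.1 hu
    refine Finset.mem_filter.2 ⟨mem_polyDegLT.2 (degree_sub_lt_of_lt ?_ ?_), (hφ _).1 ?_⟩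
    · exact degree_mul_lt_of_natDegree_add_le hu₂ (by omega)
    · exact degree_mul_lt_of_natDegree_add_le hu₁ (by omega)
    · rw [map_sub, map_mul, map_mul, hu, ha]
      ring
  calc #(boxLattice φ a M N)
      ≤ Nat.card K ^ h * #{p ∈ polyDegLT K (M + N - h) | F ∣ p} :=
        Finset.card_le_mul_card_image_of_maps_to hmaps _
          fun d _ => card_filter_boxLattice_le hbc hb hc d
    _ ≤ Nat.card K ^ h * Nat.card K ^ (M + N - h - F.natDegree) :=
        Nat.mul_le_mul_left _ (card_filter_dvd_polyDegLT_le hF _)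

theorem exists_isCoprime_of_mem_boxLattice [IsDomain R] {a : R} {M N : ℕ} {u : K[X] × K[X]}
    (hu : u ∈ boxLattice φ a M N) (hu₂ : φ u.2 ≠ 0) :
    ∃ b c : K[X], IsCoprime b c ∧ b.degree < M ∧ c.degree < N ∧ φ c ≠ 0 ∧ φ b = a * φ c := by
  classical
  obtain ⟨⟨hM, hN⟩, hua⟩ := mem_boxLattice.1 hu
  obtain ⟨b, c, hb, hc, hunit⟩ := extract_gcd u.1 u.2
  generalize gcd u.1 u.2 = g at hb hc
  have hφc : φ g * φ c ≠ 0 := by rwa [← map_mul, ← hc]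
  have hg : g ≠ 0 := fun h => hφc (by rw [h, map_zero, zero_mul])
  have hdeg : ∀ p : K[X], p.degree ≤ (g * p).degree := fun p => by
    rw [degree_mul]
    exact le_add_of_nonneg_left (zero_le_degree_iff.2 hg)
  refine ⟨b, c, (gcd_isUnit_iff b c).1 hunit, (hdeg b).trans_lt (hb ▸ hM),
    (hdeg c).trans_lt (hc ▸ hN), right_ne_zero_of_mul hφc,
    mul_left_cancel₀ (left_ne_zero_of_mul hφc) ?_⟩
  rw [← map_mul, ← hb, hua, hc, map_mul]
  ring

theorem card_boxLattice_le_or [IsDomain R] (hφ : ∀ p, φ p = 0 ↔ F ∣ p) (hF : F ≠ 0) {a : R}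
    (ha : a ≠ 0) {M N : ℕ} (hN : N ≤ F.natDegree) :
    (∀ u ∈ boxLattice φ a M N, u.2 = 0) ∨
      #(boxLattice φ a M N) * Nat.card K ^ F.natDegree ≤ Nat.card K ^ (M + N) ∨
      ∃ h ∈ Finset.Icc 1 N, IsSmallQuotient φ (M - h + 1) (N - h + 1) a ∧
        #(boxLattice φ a M N) ≤ Nat.card K ^ h := by
  refine or_iff_not_imp_left.2 fun hexists => ?_
  push Not at hexists
  obtain ⟨u, hu, hu₂⟩ := hexists
  have hdeg : u.2.degree < F.degree := by
    rw [degree_eq_natDegree hF]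
    exact (mem_boxLattice.1 hu).1.2.trans_le (Nat.cast_le.2 hN)
  obtain ⟨b, c, hbc, hbM, hcN, hφc, hφb⟩ :=
    exists_isCoprime_of_mem_boxLattice hu (map_ne_zero_of_degree_lt hφ hu₂ hdeg)
  have hc : c ≠ 0 := by
    rintro rfl
    exact hφc (map_zero φ)
  have hb : b ≠ 0 := by
    rintro rfl
    exact mul_ne_zero ha hφc (by rw [← hφb, map_zero])
  rw [← natDegree_lt_iff_degree_lt hb] at hbM
  rw [← natDegree_lt_iff_degree_lt hc] at hcN
  have hcard := card_boxLattice_le hφ hF hbc hb hc hbM.le hcN.le hφb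
  set h := min (M - b.natDegree) (N - c.natDegree)
  rcases le_total (M + N - h) F.natDegree with hle | hle
  · refine Or.inr ⟨h, Finset.mem_Icc.2 (by omega), ⟨b, c, ?_, ?_, hφc, hφb⟩, ?_⟩
    · rw [← natDegree_lt_iff_degree_lt hb]
      omega
    · rw [← natDegree_lt_iff_degree_lt hc]
      omega
    · simpa [Nat.sub_eq_zero_of_le hle] using hcard
  · left
    refine (Nat.mul_le_mul_right _ hcard).trans_eq ?_
    rw [← pow_add, ← pow_add]
    congr 1
    omega

open scoped Classical in
theorem card_filter_isSmallQuotient_sq_le [IsDomain R] [Fintype R] (M N : ℕ) :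
    #{l : R | IsSmallQuotient φ M N (l ^ 2)} ≤ 2 * Nat.card K ^ (M + N) := by
  have hfibre : ∀ v : K[X] × K[X], #{l : R | φ v.2 ≠ 0 ∧ φ v.1 = l ^ 2 * φ v.2} ≤ 2 := by
    intro v
    obtain hempty | ⟨k, hk⟩ :=
      Finset.eq_empty_or_nonempty {l : R | φ v.2 ≠ 0 ∧ φ v.1 = l ^ 2 * φ v.2}
    · simp only [hempty, Finset.card_empty, zero_le]
    · refine (Finset.card_le_card fun l hl => ?_).trans (card_filter_sq_eq_le_two (k ^ 2))
      simp only [Finset.mem_filter, Finset.mem_univ, true_and] at hk hl ⊢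
      exact mul_right_cancel₀ hl.1 (hl.2.symm.trans hk.2)
  rw [mul_comm, pow_add, ← card_polyDegLT, ← card_polyDegLT, ← Finset.card_product]
  refine (Finset.card_le_card fun l hl => ?_).trans
    (Finset.card_biUnion_le_card_mul (polyDegLT K M ×ˢ polyDegLT K N) _ _ fun v _ => hfibre v)
  obtain ⟨b, c, hb, hc, hφc, hφb⟩ := (Finset.mem_filter.1 hl).2
  exact Finset.mem_biUnion.2 ⟨(b, c), Finset.mem_product.2 ⟨mem_polyDegLT.2 hb, mem_polyDegLT.2 hc⟩,
    Finset.mem_filter.2 ⟨Finset.mem_univ l, hφc, hφb⟩⟩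

end BoxLattice

section SquareRootsInProgressions

theorem card_filter_sq_eq_sq_le {S : Type*} [CommRing S] [NoZeroDivisors S] [DecidableEq S]
    (P : Finset S) :
    #{w ∈ P ×ˢ P | w.1 ^ 2 = w.2 ^ 2} ≤ 2 * #P := by
  have hcover : {w ∈ P ×ˢ P | w.1 ^ 2 = w.2 ^ 2} ⊆
      P.image (fun x => (x, x)) ∪ P.image (fun x => (x, -x)) := by
    rintro ⟨x, y⟩ hxy
    obtain ⟨hmem, hsq⟩ := Finset.mem_filter.1 hxy
    have hx : x ∈ P := (Finset.mem_product.1 hmem).1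
    obtain rfl | rfl : y = x ∨ y = -x := sq_eq_sq_iff_eq_or_eq_neg.1 hsq.symm
    · exact Finset.mem_union_left _ (Finset.mem_image_of_mem _ hx)
    · exact Finset.mem_union_right _ (Finset.mem_image_of_mem _ hx)
  calc _ ≤ #(P.image fun x => (x, x)) + #(P.image fun x => (x, -x)) :=
        (Finset.card_le_card hcover).trans (Finset.card_union_le _ _)
    _ ≤ 2 * #P := by
        rw [two_mul]
        exact Nat.add_le_add Finset.card_image_le Finset.card_image_le

variable {K : Type*} [Field K] {R : Type*} [CommRing R] [IsDomain R] {φ : K[X] →+* R} {F : K[X]}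

theorem sq_eq_sq_of_map_sq_eq_sq (hφ : ∀ p, φ p = 0 ↔ F ∣ p) {w z : K[X]} (hw : w.degree < F.degree)
    (hz : z.degree < F.degree) (h : φ w ^ 2 = φ z ^ 2) : w ^ 2 = z ^ 2 := by
  rcases sq_eq_sq_iff_eq_or_eq_neg.1 h with h | h
  · rw [← sub_eq_zero, ← map_sub, hφ] at h
    rw [sub_eq_zero.1 (eq_zero_of_dvd_of_degree_lt h (degree_sub_lt_of_lt hw hz))]
  · rw [← sub_eq_zero, ← map_neg, ← map_sub, hφ] at h
    have hneg := degree_sub_lt_of_lt hw ((degree_neg z).trans_lt hz)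
    rw [sub_eq_zero.1 (eq_zero_of_dvd_of_degree_lt h hneg), neg_sq]

variable [Finite K]

open scoped Classical in
/-- The polynomials `w` of degree less than `m` whose square has its residue in the progression of
the residues `a s + e` with `deg s < m`. -/
noncomputable def progressionSqrts (φ : K[X] →+* R) (m : ℕ) (a e : R) : Finset K[X] :=
  {w ∈ polyDegLT K m | ∃ s ∈ polyDegLT K m, φ w ^ 2 = a * φ s + e}

open scoped Classical in
/-- Two square roots `w, w'` with parameters `s, s'` give the lattice point `(w² - w'², s - s')`,
which determines `(w, w')` up to the divisor bound. -/
theorem card_filter_sq_ne_sq_progressionSqrts_le (hφ : ∀ p, φ p = 0 ↔ F ∣ p) (hF : F ≠ 0)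
    (h2 : (2 : K) ≠ 0) {m : ℕ} (hm : m ≤ F.natDegree) (a e : R) :
    #{w ∈ progressionSqrts φ m a e ×ˢ progressionSqrts φ m a e | ¬ w.1 ^ 2 = w.2 ^ 2} ≤
      divisorBound (Nat.card K) (2 * m) * #{u ∈ boxLattice φ a (2 * m) m | u.2 ≠ 0} := by
  set P := progressionSqrts φ m a e
  set T := {u ∈ boxLattice φ a (2 * m) m | u.2 ≠ 0}
  have hroot : ∀ w ∈ P, w.degree < m ∧ ∃ s : K[X], s.degree < m ∧ φ w ^ 2 = a * φ s + e := by
    simp only [P, progressionSqrts, Finset.mem_filter, mem_polyDegLT]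
    exact fun _ => id
  choose! hdeg s hsdeg hs using hroot
  have hmF : (m : WithBot ℕ) ≤ F.degree := by
    rw [degree_eq_natDegree hF]
    exact Nat.cast_le.2 hm
  have hsqdeg : ∀ w ∈ P, (w ^ 2).degree < (2 * m : ℕ) := fun w hw => by
    rw [sq]
    exact degree_mul_lt_of_natDegree_add_le (hdeg w hw)
      (by have := natDegree_le_of_degree_le (hdeg w hw).le; omega)
  have hmaps : ∀ w ∈ {w ∈ P ×ˢ P | ¬ w.1 ^ 2 = w.2 ^ 2},
      (w.1 ^ 2 - w.2 ^ 2, s w.1 - s w.2) ∈ {u ∈ T | u.1 ≠ 0} := by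
    rintro ⟨w, z⟩ hwz
    simp only [Finset.mem_filter, Finset.mem_product] at hwz
    obtain ⟨⟨hw, hz⟩, hne⟩ := hwz
    simp only [T, Finset.mem_filter, mem_boxLattice]
    refine ⟨⟨⟨⟨degree_sub_lt_of_lt (hsqdeg w hw) (hsqdeg z hz),
      degree_sub_lt_of_lt (hsdeg w hw) (hsdeg z hz)⟩, ?_⟩, fun hsub => hne ?_⟩, sub_ne_zero.2 hne⟩
    · rw [map_sub, map_sub, map_pow, map_pow, hs w hw, hs z hz]
      ring
    · refine sq_eq_sq_of_map_sq_eq_sq hφ ((hdeg w hw).trans_le hmF) ((hdeg z hz).trans_le hmF) ?_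
      rw [hs w hw, hs z hz, sub_eq_zero.1 hsub]
  refine (Finset.card_le_mul_card_image_of_maps_to hmaps _ fun u hu => ?_).trans
    (Nat.mul_le_mul_left _ (Finset.card_filter_le _ _))
  obtain ⟨huT, hu⟩ := Finset.mem_filter.1 hu
  have hudeg := (mem_boxLattice.1 (Finset.mem_filter.1 huT).1).1.1
  exact card_le_divisorBound_of_sq_sub_sq h2 hu (natDegree_le_of_degree_le hudeg.le)
    fun w hw => congrArg Prod.fst (Finset.mem_filter.1 hw).2

open scoped Classical in
theorem card_progressionSqrts_sq_le (hφ : ∀ p, φ p = 0 ↔ F ∣ p) (hF : F ≠ 0) (h2 : (2 : K) ≠ 0)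
    {m : ℕ} (hm : m ≤ F.natDegree) (a e : R) :
    #(progressionSqrts φ m a e) ^ 2 ≤
      4 + 2 * (divisorBound (Nat.card K) (2 * m) * #{u ∈ boxLattice φ a (2 * m) m | u.2 ≠ 0}) := by
  have hoff := card_filter_sq_ne_sq_progressionSqrts_le hφ hF h2 hm a e
  set P := progressionSqrts φ m a e
  set T := {u ∈ boxLattice φ a (2 * m) m | u.2 ≠ 0}
  have hsplit : #P ^ 2 ≤ 2 * #P + divisorBound (Nat.card K) (2 * m) * #T := by
    rw [sq, ← Finset.card_product,
      ← Finset.card_filter_add_card_filter_not (fun w : K[X] × K[X] => w.1 ^ 2 = w.2 ^ 2)]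
    exact Nat.add_le_add (card_filter_sq_eq_sq_le P) hoff
  linarith [two_mul_le_add_sq (#P) 2]

end SquareRootsInProgressions

section SquareRootShifts

variable {K : Type*} [Field K] [Finite K] {R : Type*} [CommRing R] {φ : K[X] →+* R} {F : K[X]}

open scoped Classical in
/-- The residues of the polynomials of degree less than `m`. -/
noncomputable def smallResidues (φ : K[X] →+* R) (m : ℕ) : Finset R :=
  (polyDegLT K m).image φ

theorem card_smallResidues_le (φ : K[X] →+* R) (m : ℕ) : #(smallResidues φ m) ≤ Nat.card K ^ m := by
  classical
  exact Finset.card_image_le.trans_eq (card_polyDegLT K m)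

variable [Fintype R]

open scoped Classical in
/-- The square roots `x` of elements of `A` such that `x + l` is also one. -/
noncomputable def sqrtShifts (A : Finset R) (l : R) : Finset R :=
  {x | x ^ 2 ∈ A ∧ (x + l) ^ 2 ∈ A}

theorem mem_sqrtShifts {A : Finset R} {l x : R} :
    x ∈ sqrtShifts A l ↔ x ^ 2 ∈ A ∧ (x + l) ^ 2 ∈ A := by
  simp only [sqrtShifts, Finset.mem_filter, Finset.mem_univ, true_and]

variable [IsDomain R]

/-- If `x² = φ u` and `(x + l)² = φ v` then `φ (v - u) = l (2 x + l)`, whose square is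
`l² φ (2 (u + v)) - l⁴`. -/
theorem card_sqrtShifts_smallResidues_le (h2 : (2 : R) ≠ 0) (m : ℕ) {l : R} (hl : l ≠ 0) :
    #(sqrtShifts (smallResidues φ m) l) ≤ #(progressionSqrts φ m (l ^ 2) (-l ^ 4)) := by
  have hlift : ∀ x ∈ sqrtShifts (smallResidues φ m) l,
      ∃ w ∈ progressionSqrts φ m (l ^ 2) (-l ^ 4), φ w = l * (2 * x + l) := by
    intro x hx
    simp only [mem_sqrtShifts, smallResidues, Finset.mem_image, mem_polyDegLT] at hx
    obtain ⟨⟨u, hu, hux⟩, v, hv, hvx⟩ := hx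
    refine ⟨v - u, ?_, ?_⟩
    · simp only [progressionSqrts, Finset.mem_filter, mem_polyDegLT]
      have hadd : (u + v).degree < m := (degree_add_le u v).trans_lt (max_lt hu hv)
      refine ⟨degree_sub_lt_of_lt hv hu, u + v + (u + v),
        (degree_add_le _ _).trans_lt (max_lt hadd hadd), ?_⟩
      rw [map_sub, map_add, map_add, hux, hvx]
      ring
    · rw [map_sub, hux, hvx]
      ring
  choose! w hw hφw using hlift
  refine Finset.card_le_card_of_injOn w hw fun x hx y hy hxy => ?_
  have heq : l * (2 * x + l) = l * (2 * y + l) := by rw [← hφw x hx, ← hφw y hy, hxy]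
  exact mul_left_cancel₀ h2 (add_right_cancel (mul_left_cancel₀ hl heq))

/-- The bound for the squared number of square root shifts that holds for all nonzero shifts other
than the exceptional ones, whose square is a small quotient. -/
noncomputable def shiftThreshold (q m r : ℕ) : ℝ :=
  4 + 2 * (divisorBound q (2 * m) * (q ^ (3 * m) / q ^ r))

theorem card_sqrtShifts_sq_le_or (hφ : ∀ p, φ p = 0 ↔ F ∣ p) (hF : F ≠ 0) (h2 : (2 : K) ≠ 0)
    {m : ℕ} (hm : m ≤ F.natDegree) {l : R} (hl : l ≠ 0) :
    (#(sqrtShifts (smallResidues φ m) l) : ℝ) ^ 2 ≤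
        shiftThreshold (Nat.card K) m F.natDegree ∨
      ∃ h ∈ Finset.Icc 1 m, IsSmallQuotient φ (2 * m - h + 1) (m - h + 1) (l ^ 2) ∧
        #(sqrtShifts (smallResidues φ m) l) ^ 2 ≤
          6 * (divisorBound (Nat.card K) (2 * m) * Nat.card K ^ h) := by
  classical
  set q := Nat.card K
  set D := divisorBound q (2 * m)
  have hq : 0 < q := Nat.card_pos
  have hD : 1 ≤ D := one_le_divisorBound hq _
  have h2R : (2 : R) ≠ 0 := by
    rw [← map_ofNat (φ.comp C) 2]
    exact (_root_.map_ne_zero (φ.comp C)).2 h2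
  set L := boxLattice φ (l ^ 2) (2 * m) m
  have hcard : #(sqrtShifts (smallResidues φ m) l) ^ 2 ≤ 4 + 2 * (D * #{u ∈ L | u.2 ≠ 0}) :=
    (Nat.pow_le_pow_left (card_sqrtShifts_smallResidues_le h2R m hl) 2).trans
      (card_progressionSqrts_sq_le hφ hF h2 hm _ _)
  have hfilter : #{u ∈ L | u.2 ≠ 0} ≤ #L := Finset.card_filter_le _ _
  rcases card_boxLattice_le_or hφ hF (pow_ne_zero 2 hl) hm (M := 2 * m) with
    h | h | ⟨h, hh, hsq, hLh⟩
  · left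
    rw [Finset.filter_eq_empty_iff.2 fun u hu => not_not.2 (h u hu)] at hcard
    calc (#(sqrtShifts (smallResidues φ m) l) : ℝ) ^ 2 ≤ 4 := by exact_mod_cast hcard
      _ ≤ shiftThreshold q m F.natDegree := le_add_of_nonneg_right (by positivity)
  · left
    have hLr : (#L : ℝ) ≤ q ^ (3 * m) / q ^ F.natDegree := by
      rw [le_div_iff₀ (by positivity)]
      exact_mod_cast h.trans_eq (by congr 1; ring)
    calc (#(sqrtShifts (smallResidues φ m) l) : ℝ) ^ 2
        ≤ 4 + 2 * (D * #{u ∈ L | u.2 ≠ 0}) := by exact_mod_cast hcard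
      _ ≤ 4 + 2 * (D * (q ^ (3 * m) / q ^ F.natDegree)) := by
        gcongr
        exact (Nat.cast_le.2 hfilter).trans hLr
  · refine Or.inr ⟨h, hh, hsq, hcard.trans ?_⟩
    have hone : 1 ≤ D * q ^ h := Nat.mul_pos hD (pow_pos hq h)
    have hle : D * #{u ∈ L | u.2 ≠ 0} ≤ D * q ^ h := Nat.mul_le_mul_left D (hfilter.trans hLh)
    omega

open scoped Classical in
theorem sum_card_sqrtShifts_pow_four_le (hφ : ∀ p, φ p = 0 ↔ F ∣ p) (hF : F ≠ 0)
    (h2 : (2 : K) ≠ 0) {m : ℕ} (hm : m ≤ F.natDegree) :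
    ∑ l : R with l ≠ 0 ∧ shiftThreshold (Nat.card K) m F.natDegree <
        (#(sqrtShifts (smallResidues φ m) l) : ℝ) ^ 2,
      #(sqrtShifts (smallResidues φ m) l) ^ 4 ≤
      72 * m * divisorBound (Nat.card K) (2 * m) ^ 2 * Nat.card K ^ (3 * m + 2) := by
  set q := Nat.card K
  set D := divisorBound q (2 * m)
  let E : ℕ → Finset R := fun h => {l | IsSmallQuotient φ (2 * m - h + 1) (m - h + 1) (l ^ 2)}
  have hpoint : ∀ l : R, l ≠ 0 ∧ shiftThreshold q m F.natDegree <
        (#(sqrtShifts (smallResidues φ m) l) : ℝ) ^ 2 →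
      #(sqrtShifts (smallResidues φ m) l) ^ 4 ≤
        ∑ h ∈ Finset.Icc 1 m, if l ∈ E h then (6 * (D * q ^ h)) ^ 2 else 0 := by
    rintro l ⟨hl, hlarge⟩
    obtain ⟨h, hh, hsq, hle⟩ :=
      (card_sqrtShifts_sq_le_or hφ hF h2 hm hl).resolve_left hlarge.not_ge
    calc #(sqrtShifts (smallResidues φ m) l) ^ 4
        = (#(sqrtShifts (smallResidues φ m) l) ^ 2) ^ 2 := by ring
      _ ≤ (6 * (D * q ^ h)) ^ 2 := Nat.pow_le_pow_left hle 2
      _ = if l ∈ E h then (6 * (D * q ^ h)) ^ 2 else 0 :=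
          (if_pos (Finset.mem_filter.2 ⟨Finset.mem_univ l, hsq⟩)).symm
      _ ≤ _ := Finset.single_le_sum
          (f := fun h => if l ∈ E h then (6 * (D * q ^ h)) ^ 2 else 0) (fun _ _ => zero_le) hh
  calc _ ≤ ∑ l : R, ∑ h ∈ Finset.Icc 1 m, (if l ∈ E h then (6 * (D * q ^ h)) ^ 2 else 0) :=
        (Finset.sum_le_sum fun l hl => hpoint l (Finset.mem_filter.1 hl).2).trans
          (Finset.sum_le_sum_of_subset (Finset.subset_univ _))
    _ = ∑ h ∈ Finset.Icc 1 m, #(E h) * (6 * (D * q ^ h)) ^ 2 := by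
        rw [Finset.sum_comm]
        simp only [Finset.sum_ite_mem, Finset.univ_inter, Finset.sum_const, smul_eq_mul]
    _ ≤ ∑ h ∈ Finset.Icc 1 m, 72 * D ^ 2 * q ^ (3 * m + 2) := by
        refine Finset.sum_le_sum fun h hh => ?_
        have hexp : 2 * m - h + 1 + (m - h + 1) + 2 * h = 3 * m + 2 := by
          have := (Finset.mem_Icc.1 hh).2
          omega
        calc #(E h) * (6 * (D * q ^ h)) ^ 2
            ≤ 2 * q ^ (2 * m - h + 1 + (m - h + 1)) * (6 * (D * q ^ h)) ^ 2 := by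
              gcongr
              exact card_filter_isSmallQuotient_sq_le _ _
          _ = 72 * D ^ 2 * q ^ (2 * m - h + 1 + (m - h + 1) + 2 * h) := by ring
          _ = 72 * D ^ 2 * q ^ (3 * m + 2) := by rw [hexp]
    _ = 72 * m * D ^ 2 * q ^ (3 * m + 2) := by
        rw [Finset.sum_const, Nat.card_Icc, add_tsub_cancel_right, smul_eq_mul]
        ring

end SquareRootShifts

section FiniteSums

variable {ι : Type*} {s : Finset ι} {f : ι → ℝ}

theorem sum_sq_le_rpow_mul_rpow (hf : ∀ i ∈ s, 0 ≤ f i) :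
    ∑ i ∈ s, f i ^ 2 ≤ (∑ i ∈ s, f i) ^ (2 / 3 : ℝ) * (∑ i ∈ s, f i ^ 4) ^ (1 / 3 : ℝ) := by
  have hpq : (3 / 2 : ℝ).HolderConjugate 3 := Real.holderConjugate_iff.2 (by norm_num)
  calc ∑ i ∈ s, f i ^ 2 = ∑ i ∈ s, f i ^ (2 / 3 : ℝ) * f i ^ (4 / 3 : ℝ) := by
        refine Finset.sum_congr rfl fun i hi => ?_
        rw [← Real.rpow_add_of_nonneg (hf i hi) (by norm_num) (by norm_num), ← Real.rpow_natCast]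
        norm_num
    _ ≤ (∑ i ∈ s, (f i ^ (2 / 3 : ℝ)) ^ (3 / 2 : ℝ)) ^ (1 / (3 / 2) : ℝ) *
          (∑ i ∈ s, (f i ^ (4 / 3 : ℝ)) ^ (3 : ℝ)) ^ (1 / 3 : ℝ) :=
        Real.inner_le_Lp_mul_Lq_of_nonneg s hpq (fun i hi => Real.rpow_nonneg (hf i hi) _)
          fun i hi => Real.rpow_nonneg (hf i hi) _
    _ = (∑ i ∈ s, f i) ^ (2 / 3 : ℝ) * (∑ i ∈ s, f i ^ 4) ^ (1 / 3 : ℝ) := by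
        congr 2
        · refine Finset.sum_congr rfl fun i hi => ?_
          rw [← Real.rpow_mul (hf i hi)]
          norm_num
        · norm_num
        · refine Finset.sum_congr rfl fun i hi => ?_
          rw [← Real.rpow_mul (hf i hi), ← Real.rpow_natCast]
          norm_num

theorem sum_sq_le_of_truncation (hf : ∀ i ∈ s, 0 ≤ f i) (T : ℝ) :
    ∑ i ∈ s, f i ^ 2 ≤ T * ∑ i ∈ s with f i ≤ T, f i +
      (∑ i ∈ s with T < f i, f i) ^ (2 / 3 : ℝ) *
        (∑ i ∈ s with T < f i, f i ^ 4) ^ (1 / 3 : ℝ) := by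
  rw [← Finset.sum_filter_add_sum_filter_not s (f · ≤ T)]
  simp only [not_le]
  gcongr
  · rw [Finset.mul_sum]
    refine Finset.sum_le_sum fun i hi => ?_
    obtain ⟨his, hiT⟩ := Finset.mem_filter.1 hi
    rw [sq]
    exact mul_le_mul_of_nonneg_right hiT (hf i his)
  · exact sum_sq_le_rpow_mul_rpow fun i hi => hf i (Finset.mem_filter.1 hi).1

theorem sum_le_card_mul_of_support [Fintype ι] {M : ℝ} (hM : ∀ i, f i ≤ M)
    (hs : ∀ i, f i ≠ 0 → i ∈ s) : ∑ i, f i ≤ #s * M :=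
  calc ∑ i, f i = ∑ i ∈ s, f i :=
        (Finset.sum_subset s.subset_univ fun i _ hi => not_not.1 (hi ∘ hs i)).symm
    _ ≤ #s * M := (Finset.sum_le_card_nsmul s f M fun i _ => hM i).trans_eq (nsmul_eq_mul _ _)

end FiniteSums

section ShiftWeight

variable {R : Type*} [CommRing R] [Fintype R] {β : R → ℝ}

/-- The correlation of `β ∘ (· ^ 2)` with its translate by `l`. -/
def shiftWeight (β : R → ℝ) (l : R) : ℝ :=
  ∑ x, β (x ^ 2) * β ((x + l) ^ 2)

theorem shiftWeight_nonneg (hβ : ∀ x, 0 ≤ β x) (l : R) : 0 ≤ shiftWeight β l :=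
  Finset.sum_nonneg fun _ _ => mul_nonneg (hβ _) (hβ _)

theorem sum_shiftWeight (β : R → ℝ) : ∑ l, shiftWeight β l = (∑ x, β (x ^ 2)) ^ 2 := by
  simp only [shiftWeight]
  rw [Finset.sum_comm, sq, Finset.sum_mul]
  refine Finset.sum_congr rfl fun x _ => ?_
  rw [← Finset.mul_sum]
  exact congrArg _ (Equiv.sum_comp (Equiv.addLeft x) fun y => β (y ^ 2))

theorem shiftWeight_zero_le (hβ : ∀ x, 0 ≤ β x) {M : ℝ} (hM : ∀ x, β x ≤ M) :
    shiftWeight β 0 ≤ M * ∑ x, β (x ^ 2) := by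
  rw [shiftWeight, Finset.mul_sum]
  refine Finset.sum_le_sum fun x _ => ?_
  rw [add_zero]
  exact mul_le_mul_of_nonneg_right (hM _) (hβ _)

theorem shiftWeight_le_mul_card_sqrtShifts (hβ : ∀ x, 0 ≤ β x) {M : ℝ} (hM : ∀ x, β x ≤ M)
    {A : Finset R} (hA : ∀ x, β x ≠ 0 → x ∈ A) (l : R) :
    shiftWeight β l ≤ M ^ 2 * #(sqrtShifts A l) := by
  have hsupp : ∀ x ∉ sqrtShifts A l, β (x ^ 2) * β ((x + l) ^ 2) = 0 := by
    intro x hx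
    by_contra hne
    exact hx (mem_sqrtShifts.2 ⟨hA _ (left_ne_zero_of_mul hne), hA _ (right_ne_zero_of_mul hne)⟩)
  calc shiftWeight β l = ∑ x ∈ sqrtShifts A l, β (x ^ 2) * β ((x + l) ^ 2) :=
        (Finset.sum_subset (Finset.subset_univ _) fun x _ => hsupp x).symm
    _ ≤ ∑ x ∈ sqrtShifts A l, M ^ 2 := by
        refine Finset.sum_le_sum fun x _ => ?_
        rw [sq M]
        exact mul_le_mul (hM _) (hM _) (hβ _) ((hβ 0).trans (hM 0))
    _ = M ^ 2 * #(sqrtShifts A l) := by rw [Finset.sum_const, nsmul_eq_mul, mul_comm]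

open scoped Classical in
theorem sum_shiftWeight_pow_four_le_of_threshold (hβ : ∀ x, 0 ≤ β x) {M : ℝ} (hM : ∀ x, β x ≤ M)
    {A : Finset R} (hA : ∀ x, β x ≠ 0 → x ∈ A) (θ : ℝ) :
    ∑ l ∈ Finset.univ.erase 0 with M ^ 2 * √θ < shiftWeight β l, shiftWeight β l ^ 4 ≤
      M ^ 8 * ∑ l with l ≠ 0 ∧ θ < (#(sqrtShifts A l) : ℝ) ^ 2, (#(sqrtShifts A l) : ℝ) ^ 4 := by
  have hle := shiftWeight_le_mul_card_sqrtShifts hβ hM hA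
  rw [Finset.mul_sum]
  refine Finset.sum_le_sum_of_subset_of_nonneg (fun l hl => ?_) (fun _ _ _ => by positivity)
    |>.trans' (Finset.sum_le_sum fun l _ => ?_)
  · obtain ⟨hl0, hlT⟩ := Finset.mem_filter.1 hl
    have hlt : √θ < #(sqrtShifts A l) :=
      lt_of_mul_lt_mul_left (hlT.trans_le (hle l)) (sq_nonneg M)
    exact Finset.mem_filter.2
      ⟨Finset.mem_univ l, Finset.ne_of_mem_erase hl0, Real.lt_sq_of_sqrt_lt hlt⟩
  · calc shiftWeight β l ^ 4 ≤ (M ^ 2 * #(sqrtShifts A l)) ^ 4 :=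
          pow_le_pow_left₀ (shiftWeight_nonneg hβ l) (hle l) 4
      _ = M ^ 8 * (#(sqrtShifts A l) : ℝ) ^ 4 := by ring

variable [IsDomain R]

open scoped Classical in
theorem sum_comp_sq_le (hβ : ∀ x, 0 ≤ β x) : ∑ x, β (x ^ 2) ≤ 2 * ∑ x, β x :=
  calc ∑ x, β (x ^ 2) = ∑ y, ∑ x with x ^ 2 = y, β (x ^ 2) :=
        (Finset.sum_fiberwise _ _ _).symm
    _ = ∑ y, (#{x | x ^ 2 = y} : ℝ) * β y := by
        refine Finset.sum_congr rfl fun y _ => ?_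
        rw [Finset.sum_congr rfl fun x hx => congrArg β (Finset.mem_filter.1 hx).2,
          Finset.sum_const, nsmul_eq_mul]
    _ ≤ ∑ y, 2 * β y := by
        refine Finset.sum_le_sum fun y _ => mul_le_mul_of_nonneg_right ?_ (hβ y)
        exact_mod_cast card_filter_sq_eq_le_two y
    _ = 2 * ∑ x, β x := (Finset.mul_sum _ _ _).symm

theorem sum_shiftWeight_le (hβ : ∀ x, 0 ≤ β x) : ∑ l, shiftWeight β l ≤ 4 * (∑ x, β x) ^ 2 := by
  rw [sum_shiftWeight]
  calc (∑ x, β (x ^ 2)) ^ 2 ≤ (2 * ∑ x, β x) ^ 2 :=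
        pow_le_pow_left₀ (Finset.sum_nonneg fun _ _ => hβ _) (sum_comp_sq_le hβ) 2
    _ = 4 * (∑ x, β x) ^ 2 := by ring

theorem shiftWeight_zero_sq_le (hβ : ∀ x, 0 ≤ β x) {M : ℝ} (hM : ∀ x, β x ≤ M) :
    shiftWeight β 0 ^ 2 ≤ 4 * (M ^ 2 * (∑ x, β x) ^ 2) :=
  calc shiftWeight β 0 ^ 2 ≤ (M * (2 * ∑ x, β x)) ^ 2 :=
        pow_le_pow_left₀ (shiftWeight_nonneg hβ 0) ((shiftWeight_zero_le hβ hM).trans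
          (mul_le_mul_of_nonneg_left (sum_comp_sq_le hβ) ((hβ 0).trans (hM 0)))) 2
    _ = 4 * (M ^ 2 * (∑ x, β x) ^ 2) := by ring

open scoped Classical in
theorem sum_shiftWeight_sq_le_of_threshold (hβ : ∀ x, 0 ≤ β x) {M : ℝ} (hM : ∀ x, β x ≤ M)
    {A : Finset R} (hA : ∀ x, β x ≠ 0 → x ∈ A) (θ : ℝ) :
    ∑ l, shiftWeight β l ^ 2 ≤
      4 * (M ^ 2 * (∑ x, β x) ^ 2) * (1 + √θ) + (4 * (∑ x, β x) ^ 2) ^ (2 / 3 : ℝ) *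
        (M ^ 8 * ∑ l with l ≠ 0 ∧ θ < (#(sqrtShifts A l) : ℝ) ^ 2,
          (#(sqrtShifts A l) : ℝ) ^ 4) ^ (1 / 3 : ℝ) := by
  have hJ := shiftWeight_nonneg hβ
  have hsum : ∀ U : Finset R, ∑ l ∈ U, shiftWeight β l ≤ 4 * (∑ x, β x) ^ 2 := fun U =>
    (Finset.sum_le_univ_sum_of_nonneg hJ).trans (sum_shiftWeight_le hβ)
  calc ∑ l, shiftWeight β l ^ 2
      = shiftWeight β 0 ^ 2 + ∑ l ∈ Finset.univ.erase 0, shiftWeight β l ^ 2 :=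
        (Finset.add_sum_erase _ _ (Finset.mem_univ 0)).symm
    _ ≤ 4 * (M ^ 2 * (∑ x, β x) ^ 2) + (M ^ 2 * √θ * (4 * (∑ x, β x) ^ 2) +
          (4 * (∑ x, β x) ^ 2) ^ (2 / 3 : ℝ) *
            (M ^ 8 * ∑ l with l ≠ 0 ∧ θ < (#(sqrtShifts A l) : ℝ) ^ 2,
              (#(sqrtShifts A l) : ℝ) ^ 4) ^ (1 / 3 : ℝ)) := by
        refine add_le_add (shiftWeight_zero_sq_le hβ hM)
          ((sum_sq_le_of_truncation (fun l _ => hJ l) (M ^ 2 * √θ)).trans ?_)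
        have hsum_nonneg : ∀ U : Finset R, 0 ≤ ∑ l ∈ U, shiftWeight β l :=
          fun U => Finset.sum_nonneg fun l _ => hJ l
        gcongr
        · exact hsum _
        · exact hsum_nonneg _
        · exact hsum _
        · exact sum_shiftWeight_pow_four_le_of_threshold hβ hM hA θ
    _ = _ := by ring

end ShiftWeight

section EnergyBound

theorem sq_mul_sq_le_rpow {B M u : ℝ} (hB : 0 ≤ B) (hM : 0 ≤ M) (hu : 0 ≤ u) (hBu : B ≤ u * M) :
    M ^ 2 * B ^ 2 ≤ B ^ (4 / 3 : ℝ) * M ^ (8 / 3 : ℝ) * u ^ (2 / 3 : ℝ) :=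
  calc M ^ 2 * B ^ 2 = M ^ 2 * (B ^ (4 / 3 : ℝ) * B ^ (2 / 3 : ℝ)) := by
        rw [← Real.rpow_add_of_nonneg hB (by norm_num) (by norm_num), ← Real.rpow_natCast B]
        norm_num
    _ ≤ M ^ 2 * (B ^ (4 / 3 : ℝ) * (u * M) ^ (2 / 3 : ℝ)) := by gcongr
    _ = B ^ (4 / 3 : ℝ) * (M ^ (2 : ℝ) * M ^ (2 / 3 : ℝ)) * u ^ (2 / 3 : ℝ) := by
        rw [Real.mul_rpow hu hM, Real.rpow_two]
        ring
    _ = B ^ (4 / 3 : ℝ) * M ^ (8 / 3 : ℝ) * u ^ (2 / 3 : ℝ) := by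
        rw [← Real.rpow_add_of_nonneg hM (by norm_num) (by norm_num)]
        norm_num

theorem rpow_two_thirds_mul_rpow_one_third_le {B M u C : ℝ} (hB : 0 ≤ B) (hM : 0 ≤ M) (hu : 0 ≤ u)
    (hC : 1 ≤ 16 * C) :
    (4 * B ^ 2) ^ (2 / 3 : ℝ) * (M ^ 8 * (C * u ^ 3)) ^ (1 / 3 : ℝ) ≤
      B ^ (4 / 3 : ℝ) * M ^ (8 / 3 : ℝ) * (u * (16 * C)) := by
  have hC0 : 0 ≤ C := by linarith
  calc (4 * B ^ 2) ^ (2 / 3 : ℝ) * (M ^ 8 * (C * u ^ 3)) ^ (1 / 3 : ℝ)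
      = ((4 * B ^ 2) ^ 2) ^ (1 / 3 : ℝ) * (M ^ 8 * (C * u ^ 3)) ^ (1 / 3 : ℝ) := by
        rw [← Real.rpow_two (4 * B ^ 2), ← Real.rpow_mul (by positivity)]
        norm_num
    _ = (B ^ 4 * M ^ 8 * u ^ 3 * (16 * C)) ^ (1 / 3 : ℝ) := by
        rw [← Real.mul_rpow (by positivity) (by positivity)]
        ring_nf
    _ = B ^ (4 / 3 : ℝ) * M ^ (8 / 3 : ℝ) * (u * (16 * C) ^ (1 / 3 : ℝ)) := by
        rw [Real.mul_rpow (by positivity) (by positivity),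
          Real.mul_rpow (by positivity) (by positivity),
          Real.mul_rpow (by positivity) (by positivity), ← Real.rpow_natCast_mul hB,
          ← Real.rpow_natCast_mul hM, ← Real.rpow_natCast_mul hu]
        norm_num
        ring
    _ ≤ B ^ (4 / 3 : ℝ) * M ^ (8 / 3 : ℝ) * (u * (16 * C)) := by
        gcongr
        exact Real.rpow_le_self_of_one_le hC (by norm_num)

theorem sqrt_shiftThreshold_le (q m r : ℕ) :
    √(shiftThreshold q m r) ≤ 2 + 2 * (divisorBound q (2 * m) * √(q ^ (3 * m) / q ^ r)) := by
  have hD : (divisorBound q (2 * m) : ℝ) ≤ divisorBound q (2 * m) ^ 2 := by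
    exact_mod_cast Nat.le_self_pow two_ne_zero _
  have hQ : (0 : ℝ) ≤ q ^ (3 * m) / q ^ r := by positivity
  refine Real.sqrt_le_iff.2 ⟨by positivity, ?_⟩
  calc shiftThreshold q m r
      ≤ 4 + 2 * (divisorBound q (2 * m) ^ 2 * (q ^ (3 * m) / q ^ r)) := by
        rw [shiftThreshold]
        gcongr
    _ = 4 + 2 * (divisorBound q (2 * m) * √(q ^ (3 * m) / q ^ r)) ^ 2 := by
        rw [mul_pow, Real.sq_sqrt hQ]
    _ ≤ (2 + 2 * (divisorBound q (2 * m) * √(q ^ (3 * m) / q ^ r))) ^ 2 := by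
        nlinarith [show 0 ≤ divisorBound q (2 * m) * √((q : ℝ) ^ (3 * m) / q ^ r) by positivity]

theorem rpow_mul_sqrt_div_pow {q : ℝ} (hq : 0 < q) (m r : ℕ) :
    (q ^ m) ^ (2 / 3 : ℝ) * √(q ^ (3 * m) / q ^ r) =
      q ^ m * q ^ (7 * (m : ℝ) / 6 - (r : ℝ) / 2) := by
  rw [Real.sqrt_eq_rpow, ← Real.rpow_natCast q m, ← Real.rpow_natCast q (3 * m),
    ← Real.rpow_natCast q r, ← Real.rpow_sub hq, ← Real.rpow_mul hq.le, ← Real.rpow_mul hq.le,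
    ← Real.rpow_add hq, ← Real.rpow_add hq]
  push_cast
  ring_nf

theorem sq_mul_sq_mul_one_add_sqrt_shiftThreshold_le {q m : ℕ} (hq : 0 < q) (r : ℕ) {B M : ℝ}
    (hB : 0 ≤ B) (hM : 0 ≤ M) (hBM : B ≤ q ^ m * M) :
    M ^ 2 * B ^ 2 * (1 + √(shiftThreshold q m r)) ≤
      B ^ (4 / 3 : ℝ) * M ^ (8 / 3 : ℝ) * (q ^ m * (3 * divisorBound q (2 * m) *
        ((q : ℝ) ^ (7 * (m : ℝ) / 6 - (r : ℝ) / 2) + 1))) := by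
  set D := divisorBound q (2 * m)
  have hD : (1 : ℝ) ≤ D := by exact_mod_cast one_le_divisorBound hq _
  have hq0 : (0 : ℝ) < q := Nat.cast_pos.2 hq
  have hq1 : (1 : ℝ) ≤ q ^ m := one_le_pow₀ (Nat.one_le_cast.2 hq)
  have hroot : ((q : ℝ) ^ m) ^ (2 / 3 : ℝ) ≤ q ^ m :=
    Real.rpow_le_self_of_one_le hq1 (by norm_num)
  set W := (q : ℝ) ^ (7 * (m : ℝ) / 6 - (r : ℝ) / 2)
  have : 0 ≤ W := Real.rpow_nonneg hq0.le _
  calc M ^ 2 * B ^ 2 * (1 + √(shiftThreshold q m r))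
      ≤ B ^ (4 / 3 : ℝ) * M ^ (8 / 3 : ℝ) * ((q : ℝ) ^ m) ^ (2 / 3 : ℝ) *
          (1 + (2 + 2 * (D * √(q ^ (3 * m) / q ^ r)))) := by
        exact mul_le_mul (sq_mul_sq_le_rpow hB hM (by positivity) hBM)
          (add_le_add_right (sqrt_shiftThreshold_le q m r) 1) (by positivity) (by positivity)
    _ = B ^ (4 / 3 : ℝ) * M ^ (8 / 3 : ℝ) * (3 * ((q : ℝ) ^ m) ^ (2 / 3 : ℝ) +
          2 * D * (((q : ℝ) ^ m) ^ (2 / 3 : ℝ) * √(q ^ (3 * m) / q ^ r))) := by ring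
    _ = B ^ (4 / 3 : ℝ) * M ^ (8 / 3 : ℝ) *
          (3 * ((q : ℝ) ^ m) ^ (2 / 3 : ℝ) + 2 * D * (q ^ m * W)) := by
        rw [rpow_mul_sqrt_div_pow hq0]
    _ ≤ B ^ (4 / 3 : ℝ) * M ^ (8 / 3 : ℝ) * (3 * D * q ^ m + 3 * D * (q ^ m * W)) := by
        gcongr
        · linarith
        · norm_num
    _ = _ := by ring

/-- The subexponential factor `q ^ g(m)` in the energy bound. -/
noncomputable def energyLoss (q m : ℕ) : ℝ :=
  2304 * q ^ 2 * m * divisorBound q (2 * m) ^ 2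

theorem energyLoss_pos {q m : ℕ} (hq : 0 < q) (hm : 0 < m) : 0 < energyLoss q m := by
  have hD := one_le_divisorBound hq (2 * m)
  unfold energyLoss
  positivity

theorem sq_mul_sq_add_rpow_mul_rpow_le {q m : ℕ} (hq : 0 < q) (hm : 0 < m) (r : ℕ) {B M S : ℝ}
    (hB : 0 ≤ B) (hM : 0 ≤ M) (hBM : B ≤ q ^ m * M) (hS0 : 0 ≤ S)
    (hS : S ≤ 72 * m * divisorBound q (2 * m) ^ 2 * q ^ (3 * m + 2)) :
    4 * (M ^ 2 * B ^ 2) * (1 + √(shiftThreshold q m r)) +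
        (4 * B ^ 2) ^ (2 / 3 : ℝ) * (M ^ 8 * S) ^ (1 / 3 : ℝ) ≤
      B ^ (4 / 3 : ℝ) * M ^ (8 / 3 : ℝ) * ((q : ℝ) ^ m * energyLoss q m *
        ((q : ℝ) ^ (7 * (m : ℝ) / 6 - (r : ℝ) / 2) + 1)) := by
  have hzero := sq_mul_sq_mul_one_add_sqrt_shiftThreshold_le hq r hB hM hBM
  rw [energyLoss]
  have hD : 1 ≤ divisorBound q (2 * m) := one_le_divisorBound hq _
  generalize divisorBound q (2 * m) = D at *
  have hW : 0 ≤ (q : ℝ) ^ (7 * (m : ℝ) / 6 - (r : ℝ) / 2) := by positivity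
  generalize (q : ℝ) ^ (7 * (m : ℝ) / 6 - (r : ℝ) / 2) = W at *
  obtain ⟨C, hC⟩ : ∃ C : ℝ, C = 72 * m * D ^ 2 * q ^ 2 := ⟨_, rfl⟩
  have hSC : S ≤ C * (q ^ m) ^ 3 := hS.trans_eq (by rw [hC]; ring)
  have hDC : (D : ℝ) ≤ C := by
    have hle : D ≤ 72 * m * D ^ 2 * q ^ 2 :=
      calc D ≤ D ^ 2 := Nat.le_self_pow two_ne_zero D
        _ ≤ 72 * m * D ^ 2 := Nat.le_mul_of_pos_left _ (by positivity)
        _ ≤ 72 * m * D ^ 2 * q ^ 2 := Nat.le_mul_of_pos_right _ (by positivity)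
    rw [hC]
    exact_mod_cast hle
  have hC1 : 1 ≤ C := (Nat.one_le_cast.2 hD).trans hDC
  calc 4 * (M ^ 2 * B ^ 2) * (1 + √(shiftThreshold q m r)) +
        (4 * B ^ 2) ^ (2 / 3 : ℝ) * (M ^ 8 * S) ^ (1 / 3 : ℝ)
      ≤ 4 * (B ^ (4 / 3 : ℝ) * M ^ (8 / 3 : ℝ) * (q ^ m * (3 * D * (W + 1)))) +
          B ^ (4 / 3 : ℝ) * M ^ (8 / 3 : ℝ) * (q ^ m * (16 * C)) := by
        refine add_le_add ((mul_assoc _ _ _).trans_le (by gcongr)) (le_trans ?_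
          (rpow_two_thirds_mul_rpow_one_third_le hB hM (by positivity) (by linarith)))
        gcongr
    _ = B ^ (4 / 3 : ℝ) * M ^ (8 / 3 : ℝ) * (q ^ m * (12 * D * (W + 1) + 16 * C)) := by ring
    _ ≤ B ^ (4 / 3 : ℝ) * M ^ (8 / 3 : ℝ) * (q ^ m * (32 * C * (W + 1))) := by
        gcongr
        linarith [mul_nonneg (sub_nonneg.2 hDC) hW, mul_nonneg (zero_le_one.trans hC1) hW]
    _ = _ := by
        rw [hC]
        ring

variable {K : Type*} [Field K] [Finite K] {R : Type*} [CommRing R] [IsDomain R] [Fintype R]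
  {φ : K[X] →+* R} {F : K[X]}

theorem sum_shiftWeight_sq_le (hφ : ∀ p, φ p = 0 ↔ F ∣ p) (hF : F ≠ 0) (h2 : (2 : K) ≠ 0) {m : ℕ}
    (hm0 : 0 < m) (hm : m ≤ F.natDegree) {β : R → ℝ} (hβ : ∀ x, 0 ≤ β x) {M : ℝ}
    (hM : ∀ x, β x ≤ M) (hsupp : ∀ x, β x ≠ 0 → x ∈ smallResidues φ m) :
    ∑ l, shiftWeight β l ^ 2 ≤
      (∑ x, β x) ^ (4 / 3 : ℝ) * M ^ (8 / 3 : ℝ) *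
        ((Nat.card K : ℝ) ^ m * energyLoss (Nat.card K) m *
          ((Nat.card K : ℝ) ^ (7 * (m : ℝ) / 6 - (F.natDegree : ℝ) / 2) + 1)) := by
  have hM0 : 0 ≤ M := (hβ 0).trans (hM 0)
  have hBM : ∑ x, β x ≤ (Nat.card K : ℝ) ^ m * M := by
    refine (sum_le_card_mul_of_support hM hsupp).trans (mul_le_mul_of_nonneg_right ?_ hM0)
    exact_mod_cast card_smallResidues_le φ m
  refine (sum_shiftWeight_sq_le_of_threshold hβ hM hsupp
    (shiftThreshold (Nat.card K) m F.natDegree)).trans (sq_mul_sq_add_rpow_mul_rpow_le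
      Nat.card_pos hm0 F.natDegree (Finset.sum_nonneg fun x _ => hβ x) hM0 hBM (by positivity) ?_)
  exact_mod_cast sum_card_sqrtShifts_pow_four_le hφ hF h2 hm

end EnergyBound

section SqrtCorrelation

variable {R : Type*} [CommRing R] [Fintype R]

/-- The correlation `∑ x, α(x²) conj(α((x + l)²))` of `α` along square roots shifted by `l`; the
energy is the sum of its squares over `l`. -/
def sqrtCorrelation (α : R → ℂ) (l : R) : ℂ :=
  ∑ x, α (x ^ 2) * (starRingEnd ℂ) (α ((x + l) ^ 2))

theorem conj_sqrtCorrelation (α : R → ℂ) (l : R) :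
    (starRingEnd ℂ) (sqrtCorrelation α l) = sqrtCorrelation α l := by
  simp only [sqrtCorrelation, map_sum, map_mul, Complex.conj_conj]
  refine Fintype.sum_equiv (Equiv.subLeft (-l)) _ _ fun x => ?_
  rw [Equiv.subLeft_apply, mul_comm, sub_add_eq_add_sub, neg_add_cancel, zero_sub, neg_sq,
    ← neg_add', neg_sq, add_comm l]

theorem norm_sqrtCorrelation_le (α : R → ℂ) (l : R) :
    ‖sqrtCorrelation α l‖ ≤ shiftWeight (fun x => ‖α x‖) l :=
  norm_sum_le_of_le _ fun x _ => by rw [norm_mul, RCLike.norm_conj]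

open scoped Classical in
theorem sum_ite_add_eq_sum_sqrtCorrelation_sq (α : R → ℂ) :
    (∑ x₁, ∑ x₂, ∑ x₃, ∑ x₄, if x₁ + x₂ = x₃ + x₄ then
      α (x₁ ^ 2) * (starRingEnd ℂ) (α (x₂ ^ 2)) * α (x₃ ^ 2) * (starRingEnd ℂ) (α (x₄ ^ 2))
      else 0) = ∑ l, sqrtCorrelation α l ^ 2 := by
  have hx₄ : ∀ x₁ x₂ x₃ x₄ : R, x₁ + x₂ = x₃ + x₄ ↔ x₄ = x₁ + (x₂ - x₃) := fun x₁ x₂ x₃ x₄ => by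
    rw [← add_sub_assoc, eq_sub_iff_add_eq, add_comm x₄, eq_comm]
  calc _ = ∑ x₁, ∑ x₃, ∑ x₂, α (x₁ ^ 2) * (starRingEnd ℂ) (α (x₂ ^ 2)) * α (x₃ ^ 2) *
            (starRingEnd ℂ) (α ((x₁ + (x₂ - x₃)) ^ 2)) := by
        simp only [hx₄, Finset.sum_ite_eq', Finset.mem_univ, if_true]
        exact Finset.sum_congr rfl fun x₁ _ => Finset.sum_comm
    _ = ∑ x₁, ∑ x₃, ∑ l, α (x₁ ^ 2) * (starRingEnd ℂ) (α ((x₁ + l) ^ 2)) *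
            (α (x₃ ^ 2) * (starRingEnd ℂ) (α ((x₃ + l) ^ 2))) := by
        refine Finset.sum_congr rfl fun x₁ _ => Finset.sum_congr rfl fun x₃ _ => ?_
        refine Fintype.sum_equiv (Equiv.subRight x₃) _ _ fun x₂ => ?_
        rw [Equiv.subRight_apply, add_sub_cancel]
        ring
    _ = ∑ l, sqrtCorrelation α l ^ 2 := by
        simp only [sqrtCorrelation, sq (∑ _, _), Finset.sum_mul_sum]
        rw [Finset.sum_comm_cycle]

end SqrtCorrelation

section SqrtEnergy

variable {K : Type u} [Field K] {F : K[X]}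

theorem mk_mod (F x : K[X]) :
    Ideal.Quotient.mk (Ideal.span {F}) (x % F) = Ideal.Quotient.mk (Ideal.span {F}) x := by
  rw [Ideal.Quotient.eq, Ideal.mem_span_singleton, EuclideanDomain.mod_eq_sub_mul_div]
  exact ⟨-(x / F), by ring⟩

variable [Finite K]

theorem bijOn_mk_polyDegLT (hF : F ≠ 0) :
    Set.BijOn (Ideal.Quotient.mk (Ideal.span {F})) (polyDegLT K F.natDegree) Set.univ := by
  refine ⟨Set.mapsTo_univ _ _, fun x hx y hy hxy => ?_, fun y _ => ?_⟩
  · rw [Ideal.Quotient.eq, Ideal.mem_span_singleton] at hxy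
    rw [Finset.mem_coe, mem_polyDegLT, ← degree_eq_natDegree hF] at hx hy
    exact sub_eq_zero.1
      (eq_zero_of_dvd_of_degree_lt hxy ((degree_sub_le x y).trans_lt (max_lt hx hy)))
  · obtain ⟨x, rfl⟩ := Ideal.Quotient.mk_surjective y
    refine ⟨x % F, ?_, mk_mod F x⟩
    rw [Finset.mem_coe, mem_polyDegLT, ← degree_eq_natDegree hF]
    exact EuclideanDomain.mod_lt x hF

theorem finite_quotient_span (hF : F ≠ 0) : Finite (K[X] ⧸ Ideal.span {F}) :=
  Set.finite_univ_iff.1 ((bijOn_mk_polyDegLT hF).image_eq ▸ (Finset.finite_toSet _).image _)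

theorem sum_polyDegLT_comp_mk (hF : F ≠ 0) [Fintype (K[X] ⧸ Ideal.span {F})]
    {A : Type*} [AddCommMonoid A] (f : (K[X] ⧸ Ideal.span {F}) → A) :
    ∑ x ∈ polyDegLT K F.natDegree, f (Ideal.Quotient.mk (Ideal.span {F}) x) = ∑ y, f y :=
  Finset.sum_nbij (Ideal.Quotient.mk (Ideal.span {F})) (fun _ _ => Finset.mem_univ _)
    (bijOn_mk_polyDegLT hF).injOn (by simpa using (bijOn_mk_polyDegLT hF).surjOn) fun _ _ => rfl

theorem sqrtEnergy_eq_sum_sqrtCorrelation_sq (hF : F ≠ 0) [Fintype (K[X] ⧸ Ideal.span {F})]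
    (α : (K[X] ⧸ Ideal.span {F}) → ℂ) : sqrtEnergy F α = ∑ l, sqrtCorrelation α l ^ 2 := by
  classical
  rw [← sum_ite_add_eq_sum_sqrtCorrelation_sq]
  simp only [← sum_polyDegLT_comp_mk hF, ← map_add, Ideal.Quotient.eq, Ideal.mem_span_singleton,
    ← map_pow]
  rfl

theorem sqrtEnergy_im (hF : F ≠ 0) (α : (K[X] ⧸ Ideal.span {F}) → ℂ) :
    (sqrtEnergy F α).im = 0 := by
  have := finite_quotient_span hF
  have := Fintype.ofFinite (K[X] ⧸ Ideal.span {F})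
  rw [← Complex.conj_eq_iff_im, sqrtEnergy_eq_sum_sqrtCorrelation_sq hF]
  simp only [map_sum, map_pow, conj_sqrtCorrelation]

theorem sqrtEnergy_re_le_sum_shiftWeight_sq (hF : F ≠ 0) [Fintype (K[X] ⧸ Ideal.span {F})]
    (α : (K[X] ⧸ Ideal.span {F}) → ℂ) :
    (sqrtEnergy F α).re ≤ ∑ l, shiftWeight (fun x => ‖α x‖) l ^ 2 := by
  rw [sqrtEnergy_eq_sum_sqrtCorrelation_sq hF]
  refine (Complex.re_le_norm _).trans (norm_sum_le_of_le _ fun l _ => ?_)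
  rw [norm_pow]
  exact pow_le_pow_left₀ (norm_nonneg _) (norm_sqrtCorrelation_le α l) 2

theorem sqrtEnergy_re_le (hF : Irreducible F) (h2 : (2 : K) ≠ 0) {m : ℕ} (hm0 : 0 < m)
    (hm : m ≤ F.natDegree) (α : (K[X] ⧸ Ideal.span {F}) → ℂ)
    (hα : ∀ x : K[X], weightAt α x ≠ 0 → degMod F x < m) :
    (sqrtEnergy F α).re ≤ l1Norm α ^ (4 / 3 : ℝ) * lInftyNorm α ^ (8 / 3 : ℝ) *
      ((Nat.card K : ℝ) ^ m * energyLoss (Nat.card K) m *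
        ((Nat.card K : ℝ) ^ (7 * (m : ℝ) / 6 - (F.natDegree : ℝ) / 2) + 1)) := by
  classical
  have hF0 := hF.ne_zero
  have := finite_quotient_span hF0
  have := Fintype.ofFinite (K[X] ⧸ Ideal.span {F})
  have : (Ideal.span {F}).IsPrime := (Ideal.span_singleton_prime hF0).2 hF.prime
  have hφ : ∀ p, Ideal.Quotient.mk (Ideal.span {F}) p = 0 ↔ F ∣ p := fun p => by
    rw [Ideal.Quotient.eq_zero_iff_mem, Ideal.mem_span_singleton]
  have hsupp : ∀ y, ‖α y‖ ≠ 0 → y ∈ smallResidues (Ideal.Quotient.mk (Ideal.span {F})) m := by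
    intro y hy
    obtain ⟨x, rfl⟩ := Ideal.Quotient.mk_surjective y
    rw [← mk_mod F x]
    exact Finset.mem_image_of_mem _ (mem_polyDegLT.2 (hα x (norm_ne_zero_iff.1 hy)))
  rw [l1Norm, finsum_eq_sum_of_fintype]
  exact (sqrtEnergy_re_le_sum_shiftWeight_sq hF0 α).trans <|
    sum_shiftWeight_sq_le hφ hF0 h2 hm0 hm (fun _ => norm_nonneg _)
      (le_ciSup (Set.finite_range fun x => ‖α x‖).bddAbove) hsupp

end SqrtEnergy

theorem isLittleO_logb_energyLoss {q : ℕ} (hq : 0 < q) :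
    (fun m : ℕ => Real.logb q (energyLoss q m)) =o[atTop] fun m : ℕ => (m : ℝ) := by
  have hlog : (fun m : ℕ => Real.log m) =o[atTop] fun m : ℕ => (m : ℝ) :=
    Real.isLittleO_log_id_atTop.comp_tendsto tendsto_natCast_atTop_atTop
  have hdiv : (fun m : ℕ => Real.log (divisorBound q (2 * m))) =o[atTop]
      fun m : ℕ => (m : ℝ) := by
    have htwo : Tendsto (fun m : ℕ => 2 * m) atTop atTop := tendsto_id.const_mul_atTop' two_pos
    refine ((isLittleO_log_divisorBound hq).comp_tendsto htwo).trans_isBigO ?_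
    refine ((isBigO_refl (fun m : ℕ => (m : ℝ)) atTop).const_mul_left 2).congr_left fun m => ?_
    simp only [Function.comp_apply, Nat.cast_mul, Nat.cast_ofNat]
  refine ((((isLittleO_const_natCast (Real.log (2304 * q ^ 2))).add hlog).add
    (hdiv.const_mul_left 2)).const_mul_left (Real.log q)⁻¹).congr' ?_ EventuallyEq.rfl
  filter_upwards [eventually_gt_atTop 0] with m hm
  have hD := one_le_divisorBound hq (2 * m)
  rw [Real.logb, energyLoss, Real.log_mul (x := 2304 * q ^ 2 * m) (by positivity) (by positivity),
    Real.log_mul (x := 2304 * q ^ 2) (by positivity) (by positivity),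
    Real.log_pow (divisorBound q (2 * m) : ℝ) 2]
  push_cast
  ring

theorem theorem2p5 (q : ℕ) (hq : Odd q) :
    ∃ g : ℕ → ℝ, g =o[atTop] (fun m : ℕ => (m : ℝ)) ∧
      ∀ (K : Type u) [Field K] [Fintype K], Fintype.card K = q →
        ∀ (F : K[X]) (r m : ℕ), Irreducible F → F.natDegree = r → 0 < m → m ≤ r →
          ∀ α : (K[X] ⧸ Ideal.span {F}) → ℂ,
            (∀ x : K[X], weightAt α x ≠ 0 → degMod F x < (m : WithBot ℕ)) →
              (sqrtEnergy F α).im = 0 ∧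
                (sqrtEnergy F α).re ≤
                  l1Norm α ^ (4 / 3 : ℝ) * lInftyNorm α ^ (8 / 3 : ℝ) *
                    (q : ℝ) ^ ((m : ℝ) + g m) *
                      ((q : ℝ) ^ (7 * (m : ℝ) / 6 - (r : ℝ) / 2) + 1) := by
  refine ⟨fun m => Real.logb q (energyLoss q m), isLittleO_logb_energyLoss hq.pos, ?_⟩
  rintro K _ _ hK F r m hF rfl hm0 hm α hα
  have hchar : ringChar K ≠ 2 := fun h =>
    Nat.not_even_iff_odd.2 hq (hK ▸ Nat.even_iff.2 (FiniteField.even_card_iff_char_two.1 h))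
  have hq0 : (0 : ℝ) < q := Nat.cast_pos.2 hq.pos
  have hq1 : q ≠ 1 := hK ▸ Fintype.one_lt_card.ne'
  have hpow : (q : ℝ) ^ ((m : ℝ) + Real.logb q (energyLoss q m)) = q ^ m * energyLoss q m := by
    rw [Real.rpow_add hq0, Real.rpow_natCast,
      Real.rpow_logb hq0 (Nat.cast_ne_one.2 hq1) (energyLoss_pos hq.pos hm0)]
  have hre := sqrtEnergy_re_le hF (Ring.two_ne_zero hchar) hm0 hm α hα
  rw [Nat.card_eq_fintype_card, hK, ← mul_assoc] at hre
  exact ⟨sqrtEnergy_im hF.ne_zero α, hpow ▸ hre⟩
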